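/- A convex body is a compact convex subset of $\mathbb{R}^2$ with nonempty interior, and lengths are measured in the standard Euclidean norm $|\cdot|$. For a convex body $K\subset\mathbb{R}^2$ let $$\xi_B(K)=\inf\Big\{\sum_{i=1}^m |q_{i+1}-q_i| \;:\; m\ge 2,\ q_1,\dots,q_m\in\mathbb{R}^2,\ \{q_1,\dots,q_m\}\not\subseteq \operatorname{int}K+t \text{ for all } t\in\mathbb{R}^2\Big\},\qquad q_{m+1}=q_1,$$ the length of the shortest closed polygonal line that cannot be translated into the interior of $K$ (that is, of the shortest closed billiard trajectory in $K$, in the sense that is used for arbitrary, not necessarily smooth, bodies). Let $K-K=\{x-y : x,y\in K\}$. Then for every convex body $K\subset\mathbb{R}^2$ $$\xi_B(K-K)\le \frac{4}{\sqrt3}\,\xi_B(K).$$ The estimate is sharp: if a real number $c$ satisfies $\xi_B(K-K)\le c\,\xi_B(K)$ for every convex body $K\subset\mathbb{R}^2$, then $c\ge 4/\sqrt3$; moreover, $\xi_B(K-K)=\frac{4}{\sqrt3}\,\xi_B(K)$ for every (nondegenerate) equilateral triangle $K$. -/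

import Mathlib

open scoped Pointwise

/-- The Euclidean plane. -/
abbrev Plane : Type := EuclideanSpace ℝ (Fin 2)

section Billiards

variable {E : Type*} [NormedAddCommGroup E]

/-- Length of the closed polygonal line `q₁ → q₂ → ⋯ → q_m → q₁`
(`finRotate m` is the cyclic successor on `Fin m`). -/
def closedLength {m : ℕ} (q : Fin m → E) : ℝ :=
  ∑ i : Fin m, ‖q (finRotate m i) - q i‖

/-- `{q₁, …, q_m}` fits into `int K + t` for some translation vector `t`. -/
def FitsInterior (K : Set E) {m : ℕ} (q : Fin m → E) : Prop :=
  ∃ t : E, Set.range q ⊆ t +ᵥ interior K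

/-- The lengths of all closed polygonal lines with `m ≥ 2` vertices that cannot be translated
into the interior of `K`. -/
def nonFittingLengths (K : Set E) : Set ℝ :=
  {l : ℝ | ∃ (m : ℕ) (q : Fin m → E), 2 ≤ m ∧ ¬ FitsInterior K q ∧ closedLength q = l}

/-- The length of the shortest closed billiard trajectory in `K`, for an arbitrary (not necessarily
smooth) convex body `K`: the minimal length of a closed polygonal line that cannot be translated
into the interior of `K`. -/
noncomputable def xi (K : Set E) : ℝ :=
  sInf (nonFittingLengths K)

theorem nonFittingLengths_bddBelow (K : Set E) : BddBelow (nonFittingLengths K) := by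
  refine ⟨0, ?_⟩
  rintro l ⟨m, q, -, -, rfl⟩
  exact Finset.sum_nonneg fun i _ => norm_nonneg _

/-- For a bounded `K` (in a nonzero space) the infimum is taken over a nonempty set. -/
theorem nonFittingLengths_nonempty [NormedSpace ℝ E] [Nontrivial E] {K : Set E}
    (hK : Bornology.IsBounded K) : (nonFittingLengths K).Nonempty := by
  obtain ⟨C, hC⟩ := Metric.isBounded_iff.1 hK
  obtain ⟨x, hx⟩ := NormedSpace.exists_lt_norm ℝ E C
  refine ⟨_, 2, ![0, x], le_rfl, ?_, rfl⟩
  rintro ⟨t, ht⟩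
  obtain ⟨a, ha, ha'⟩ := ht ⟨0, rfl⟩
  obtain ⟨b, hb, hb'⟩ := ht ⟨1, rfl⟩
  have h := hC (interior_subset hb) (interior_subset ha)
  have e : b - a = x := by
    simp only [vadd_eq_add, Matrix.cons_val_zero, Matrix.cons_val_one] at ha' hb'
    rw [← hb', ← sub_zero (t + b), ← ha']
    abel
  rw [dist_eq_norm, e] at h
  exact absurd h (not_le.2 hx)

end Billiards

/-! Upper bound: by Helly, a line that does not fit into `int K` has three vertices that do not fit,
of perimeter P at most its length. Separation gives normals u + v + w = 0 whose support values sum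
to at most ⟪u, a⟫ + ⟪v, b⟫ + ⟪w, c⟫. As u, v, w are the sides of a triangle, the dual Jung estimate
`sum_inner_le_of_norm_sub_le` bounds this by r * P / √3, r being the largest norm. Evaluating the
other two normals at a common point leaves r times the width of `K` along the longest normal, so
that width is at most P / √3. Bouncing across `K - K` in this direction costs four widths.

Sharpness: for an equilateral triangle of side a, the medial triangle gives xi K ≤ 3a/2, while `K -
K` contains the open disc of radius a√3/2 about 0 and so forces length at least 2√3 a =
(4/√3)(3a/2). -/

/-! ### Reduction to triangles by Helly's theorem -/

section Polygons

variable {E : Type*} [NormedAddCommGroup E]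

/-- The perimeter of a triangle with vertices on a closed polygonal line is at most the length of
that line. -/
theorem triangle_le_closedLength_of_le {m : ℕ} (q : Fin m → E) {i j k : Fin m}
    (hij : i ≤ j) (hjk : j ≤ k) :
    dist (q i) (q j) + dist (q j) (q k) + dist (q k) (q i) ≤ closedLength q := by
  obtain ⟨n, rfl⟩ : ∃ n, m = n + 1 := ⟨m - 1, by have := i.isLt; omega⟩
  -- Periodic extension of `q`: the closed line becomes the path `p 0, …, p (n + 1)` with `p (n + 1)
  -- = p 0`.
  let p : ℕ → E := fun l => q (Fin.ofNat (n + 1) l)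
  have hp : ∀ l : Fin (n + 1), p l = q l := fun l => by simp [p]
  have hlast : p (n + 1) = p 0 := by simp [p, Fin.ofNat]
  have hL : closedLength q = ∑ l ∈ Finset.range (n + 1), dist (p l) (p (l + 1)) := by
    rw [Finset.sum_range, closedLength]
    refine Finset.sum_congr rfl fun l _ => ?_
    rw [dist_comm, dist_eq_norm, hp l, finRotate_apply]
    congr 3
    ext
    simp [Fin.val_add, Fin.ofNat]
  have h1 := dist_le_Ico_sum_dist p (show (i : ℕ) ≤ j from hij)
  have h2 := dist_le_Ico_sum_dist p (show (j : ℕ) ≤ k from hjk)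
  have h3 := dist_le_Ico_sum_dist p (show (k : ℕ) ≤ n + 1 from k.isLt.le)
  have h4 := dist_le_Ico_sum_dist p (Nat.zero_le (i : ℕ))
  have h5 := dist_triangle (p k) (p 0) (p i)
  have e1 := Finset.sum_Ico_consecutive (fun l => dist (p l) (p (l + 1))) (Nat.zero_le (i : ℕ))
    (show (i : ℕ) ≤ j from hij)
  have e2 := Finset.sum_Ico_consecutive (fun l => dist (p l) (p (l + 1))) (Nat.zero_le (j : ℕ))
    (show (j : ℕ) ≤ k from hjk)
  have e3 := Finset.sum_Ico_consecutive (fun l => dist (p l) (p (l + 1))) (Nat.zero_le (k : ℕ))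
    (show (k : ℕ) ≤ n + 1 from k.isLt.le)
  rw [hL, Finset.range_eq_Ico, ← hp i, ← hp j, ← hp k]
  rw [hlast] at h3
  linarith

theorem triangle_le_closedLength {m : ℕ} (q : Fin m → E) (i j k : Fin m) :
    dist (q i) (q j) + dist (q j) (q k) + dist (q k) (q i) ≤ closedLength q := by
  have c1 := dist_comm (q i) (q j)
  have c2 := dist_comm (q j) (q k)
  have c3 := dist_comm (q k) (q i)
  rcases le_total i j with hij | hij <;> rcases le_total j k with hjk | hjk <;>
    rcases le_total i k with hik | hik
  all_goals first
    | linarith [triangle_le_closedLength_of_le q hij hjk]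
    | linarith [triangle_le_closedLength_of_le q hij hik]
    | linarith [triangle_le_closedLength_of_le q hik hjk]
    | linarith [triangle_le_closedLength_of_le q hjk hij]
    | linarith [triangle_le_closedLength_of_le q hjk hik]
    | linarith [triangle_le_closedLength_of_le q hik hij]

/-- A finset with at most three elements is contained in some `{i, j, k}`. -/
theorem Finset.subset_triple_of_card_le_three {ι : Type*} [DecidableEq ι] [Nonempty ι]
    {I : Finset ι} (hI : I.card ≤ 3) : ∃ i j k, I ⊆ {i, j, k} := by
  obtain ⟨i₀⟩ := ‹Nonempty ι›
  have : I.card = 0 ∨ I.card = 1 ∨ I.card = 2 ∨ I.card = 3 := by omega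
  rcases this with h | h | h | h
  · exact ⟨i₀, i₀, i₀, by simp [Finset.card_eq_zero.1 h]⟩
  · obtain ⟨i, rfl⟩ := Finset.card_eq_one.1 h
    exact ⟨i, i, i, by simp⟩
  · obtain ⟨i, j, -, rfl⟩ := Finset.card_eq_two.1 h
    exact ⟨i, j, j, by simp⟩
  · obtain ⟨i, j, k, -, -, -, rfl⟩ := Finset.card_eq_three.1 h
    exact ⟨i, j, k, le_rfl⟩

/-- By Helly's theorem, a polygonal line in the plane which does not fit into the interior of `K`
has three vertices which already do not. -/
theorem exists_triple_of_not_fitsInterior [NormedSpace ℝ E] [FiniteDimensional ℝ E]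
    (hE : Module.finrank ℝ E = 2) {K : Set E} (hK : Convex ℝ K) {m : ℕ} (hm : 2 ≤ m)
    {q : Fin m → E} (hq : ¬ FitsInterior K q) :
    ∃ i j k, ∀ t, ¬ (q i - t ∈ interior K ∧ q j - t ∈ interior K ∧ q k - t ∈ interior K) := by
  by_contra! h
  apply hq
  have : Nonempty (Fin m) := ⟨⟨0, by omega⟩⟩
  -- Helly is applied to the sets of translations that bring one vertex into the interior.
  obtain ⟨t, ht⟩ := Convex.helly_theorem' (𝕜 := ℝ) (F := fun i => {t | q i - t ∈ interior K})
    (s := Finset.univ)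
    (fun i _ => by
      have : {t | q i - t ∈ interior K} = {q i} - interior K := by
        ext t
        simp only [Set.singleton_sub, Set.mem_image, Set.mem_ofPred_eq]
        exact ⟨fun h => ⟨_, h, by abel⟩, by rintro ⟨x, hx, rfl⟩; simpa using hx⟩
      show Convex ℝ {t | q i - t ∈ interior K}
      rw [this]
      exact (convex_singleton _).sub hK.interior)
    (fun I _ hI => by
      obtain ⟨i, j, k, hIs⟩ := Finset.subset_triple_of_card_le_three (hE ▸ hI : I.card ≤ 2 + 1)
      obtain ⟨t, h1, h2, h3⟩ := h i j k
      refine ⟨t, Set.mem_iInter₂.2 fun l hl => ?_⟩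
      have := hIs hl
      simp only [Finset.mem_insert, Finset.mem_singleton] at this
      rcases this with rfl | rfl | rfl
      exacts [h1, h2, h3])
  refine ⟨t, ?_⟩
  rintro _ ⟨i, rfl⟩
  rw [Set.mem_vadd_set_iff_neg_vadd_mem, vadd_eq_add, neg_add_eq_sub]
  exact Set.mem_iInter₂.1 ht i (Finset.mem_univ _)

end Polygons

/-! ### The inequality: supporting normals, Jung's estimate, widths -/

section Inner

variable {E : Type*} [NormedAddCommGroup E] [InnerProductSpace ℝ E]

local notation "⟪" x ", " y "⟫" => inner ℝ x y

/-- If a triple of points cannot be translated into the interior of a convex set, then this is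
witnessed by three supporting half-spaces whose normals sum to zero. -/
theorem exists_normals_of_not_fits [CompleteSpace E] {K : Set E} (hK : Convex ℝ K)
    (hne : (interior K).Nonempty) {a b c : E}
    (h : ∀ t, ¬ (a - t ∈ interior K ∧ b - t ∈ interior K ∧ c - t ∈ interior K)) :
    ∃ u v w : E, u + v + w = 0 ∧ ∀ x ∈ interior K, ∀ y ∈ interior K, ∀ z ∈ interior K,
      ⟪u, x⟫ + ⟪v, y⟫ + ⟪w, z⟫ < ⟪u, a⟫ + ⟪v, b⟫ + ⟪w, c⟫ := by
  set U := interior K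
  -- Not fitting means that (a, b, c) lies outside the open convex set U³ + D.
  let D : Set (E × E × E) := Set.range fun t : E => (t, t, t)
  have hD : Convex ℝ D := by
    rintro _ ⟨s, rfl⟩ _ ⟨t, rfl⟩ α β - - -
    exact ⟨α • s + β • t, rfl⟩
  have hU : Convex ℝ (U ×ˢ U ×ˢ U) := hK.interior.prod (hK.interior.prod hK.interior)
  have hUo : IsOpen (U ×ˢ U ×ˢ U) :=
    isOpen_interior.prod (isOpen_interior.prod isOpen_interior)
  obtain ⟨f, hf⟩ := geometric_hahn_banach_open_point (x := (a, b, c)) (hU.add hD)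
    (hUo.add_right) (by
      rintro ⟨⟨x, y, z⟩, ⟨hx, hy, hz⟩, _, ⟨t, rfl⟩, e⟩
      simp only [Prod.mk_add_mk, Prod.mk.injEq] at e
      obtain ⟨rfl, rfl, rfl⟩ := e
      exact h t ⟨by simpa using hx, by simpa using hy, by simpa using hz⟩)
  have hf' : ∀ x ∈ U, ∀ y ∈ U, ∀ z ∈ U, ∀ t : E, f (x, y, z) + f (t, t, t) < f (a, b, c) := by
    intro x hx y hy z hz t
    rw [← map_add]
    exact hf _ (Set.add_mem_add ⟨hx, hy, hz⟩ ⟨t, rfl⟩)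
  -- A functional bounded above on a linear subspace vanishes there; this makes the normals sum to
  -- zero.
  have hdiag : ∀ t : E, f (t, t, t) = 0 := by
    intro t
    obtain ⟨x, hx⟩ := hne
    by_contra h0
    have := hf' x hx x hx x hx (((f (a, b, c) - f (x, x, x)) / f (t, t, t)) • t)
    have e : f ((((f (a, b, c) - f (x, x, x)) / f (t, t, t)) • t),
        (((f (a, b, c) - f (x, x, x)) / f (t, t, t)) • t),
        (((f (a, b, c) - f (x, x, x)) / f (t, t, t)) • t)) = f (a, b, c) - f (x, x, x) := by
      rw [← Prod.smul_mk, ← Prod.smul_mk, map_smul, smul_eq_mul, div_mul_cancel₀ _ h0]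
    rw [e] at this
    linarith
  let d := (InnerProductSpace.toDual ℝ E).symm
  let g₁ := f.comp (ContinuousLinearMap.inl ℝ E (E × E))
  let g₂ := f.comp ((ContinuousLinearMap.inr ℝ E (E × E)).comp (ContinuousLinearMap.inl ℝ E E))
  let g₃ := f.comp ((ContinuousLinearMap.inr ℝ E (E × E)).comp (ContinuousLinearMap.inr ℝ E E))
  have hsum : ∀ x y z : E, ⟪d g₁, x⟫ + ⟪d g₂, y⟫ + ⟪d g₃, z⟫ = f (x, y, z) := by
    intro x y z
    simp only [d, InnerProductSpace.toDual_symm_apply]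
    simp only [g₁, g₂, g₃, ContinuousLinearMap.comp_apply, ContinuousLinearMap.inl_apply,
      ContinuousLinearMap.inr_apply, ← map_add]
    simp
  refine ⟨d g₁, d g₂, d g₃, ?_, ?_⟩
  · refine ext_inner_right ℝ fun t => ?_
    rw [inner_add_left, inner_add_left, hsum, hdiag, inner_zero_left]
  · intro x hx y hy z hz
    rw [hsum, hsum]
    simpa [hdiag] using hf' x hx y hy z hz 0

/-- The weighted second moment about the centroid in terms of the pairwise distances. -/
theorem sum_mul_weighted_norm_sq {x y z : E} {α β γ : ℝ} (h : α • x + β • y + γ • z = 0) :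
    (α + β + γ) * (α * ‖x‖ ^ 2 + β * ‖y‖ ^ 2 + γ * ‖z‖ ^ 2) =
      α * β * ‖x - y‖ ^ 2 + β * γ * ‖y - z‖ ^ 2 + γ * α * ‖z - x‖ ^ 2 := by
  have h2 : ‖α • x + β • y + γ • z‖ ^ 2 = 0 := by simp [h]
  have c := real_inner_comm x z
  simp only [norm_add_sq_real, norm_sub_sq_real, norm_smul, mul_pow, inner_add_left,
    inner_smul_left, inner_smul_right, Real.norm_eq_abs, sq_abs, conj_trivial] at h2 ⊢
  rw [c]
  linear_combination h2

/-- A quantitative form of Jung's theorem for triangles, dual to the circumradius bound. -/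
theorem sum_inner_le_of_norm_sub_le {d₁ d₂ d₃ v₁ v₂ v₃ : E} (hd : d₁ + d₂ + d₃ = 0) {r : ℝ}
    (h₁₂ : ‖v₁ - v₂‖ ≤ r) (h₂₃ : ‖v₂ - v₃‖ ≤ r) (h₃₁ : ‖v₃ - v₁‖ ≤ r) :
    ⟪v₁, d₁⟫ + ⟪v₂, d₂⟫ + ⟪v₃, d₃⟫ ≤ r * (‖d₁‖ + ‖d₂‖ + ‖d₃‖) / √3 := by
  set l₁ := ‖d₁‖ with hl₁
  set l₂ := ‖d₂‖ with hl₂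
  set l₃ := ‖d₃‖ with hl₃
  have n₁ : 0 ≤ l₁ := norm_nonneg _
  have n₂ : 0 ≤ l₂ := norm_nonneg _
  have n₃ : 0 ≤ l₃ := norm_nonneg _
  have hr : 0 ≤ r := (norm_nonneg _).trans h₁₂
  set l := l₁ + l₂ + l₃ with hl
  rcases (show 0 ≤ l by positivity).eq_or_lt with h0 | hpos
  · have z₁ : d₁ = 0 := norm_eq_zero.1 (by linarith)
    have z₂ : d₂ = 0 := norm_eq_zero.1 (by linarith)
    have z₃ : d₃ = 0 := norm_eq_zero.1 (by linarith)
    simp [z₁, z₂, z₃, ← h0]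
  -- Since the `d`'s sum to zero, any origin may be used; this weighted centroid turns the
  -- Cauchy–Schwarz bound below into pairwise distances.
  let o : E := l⁻¹ • (l₁ • v₁ + l₂ • v₂ + l₃ • v₃)
  have ho : l • o = l₁ • v₁ + l₂ • v₂ + l₃ • v₃ := smul_inv_smul₀ hpos.ne' _
  have hshift : ⟪v₁, d₁⟫ + ⟪v₂, d₂⟫ + ⟪v₃, d₃⟫
      = ⟪v₁ - o, d₁⟫ + ⟪v₂ - o, d₂⟫ + ⟪v₃ - o, d₃⟫ := by
    have : ⟪o, d₁⟫ + ⟪o, d₂⟫ + ⟪o, d₃⟫ = 0 := by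
      rw [← inner_add_right, ← inner_add_right, hd, inner_zero_right]
    simp only [inner_sub_left]
    linarith
  set a₁ := ‖v₁ - o‖
  set a₂ := ‖v₂ - o‖
  set a₃ := ‖v₃ - o‖
  have hle : ⟪v₁, d₁⟫ + ⟪v₂, d₂⟫ + ⟪v₃, d₃⟫ ≤ a₁ * l₁ + a₂ * l₂ + a₃ * l₃ := by
    rw [hshift]
    exact add_le_add (add_le_add (real_inner_le_norm _ _) (real_inner_le_norm _ _))
      (real_inner_le_norm _ _)
  have hcs : (a₁ * l₁ + a₂ * l₂ + a₃ * l₃) ^ 2 ≤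
      l * (l₁ * a₁ ^ 2 + l₂ * a₂ ^ 2 + l₃ * a₃ ^ 2) := by
    have e₁ := mul_nonneg (mul_nonneg n₁ n₂) (sq_nonneg (a₁ - a₂))
    have e₂ := mul_nonneg (mul_nonneg n₂ n₃) (sq_nonneg (a₂ - a₃))
    have e₃ := mul_nonneg (mul_nonneg n₁ n₃) (sq_nonneg (a₁ - a₃))
    rw [hl]
    linarith
  have hvar : l * (l₁ * a₁ ^ 2 + l₂ * a₂ ^ 2 + l₃ * a₃ ^ 2) =
      l₁ * l₂ * ‖v₁ - v₂‖ ^ 2 + l₂ * l₃ * ‖v₂ - v₃‖ ^ 2 + l₃ * l₁ * ‖v₃ - v₁‖ ^ 2 := by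
    have hz : l₁ • (v₁ - o) + l₂ • (v₂ - o) + l₃ • (v₃ - o) = 0 := by
      have : l • o = l₁ • o + l₂ • o + l₃ • o := by rw [hl, add_smul, add_smul]
      rw [this] at ho
      simp only [smul_sub]
      rw [← sub_eq_zero] at ho
      rw [← neg_eq_zero, ← ho]
      abel
    rw [show v₁ - v₂ = (v₁ - o) - (v₂ - o) by abel, show v₂ - v₃ = (v₂ - o) - (v₃ - o) by abel,
      show v₃ - v₁ = (v₃ - o) - (v₁ - o) by abel]
    exact sum_mul_weighted_norm_sq hz
  have s₁ : ‖v₁ - v₂‖ ^ 2 ≤ r ^ 2 := by gcongr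
  have s₂ : ‖v₂ - v₃‖ ^ 2 ≤ r ^ 2 := by gcongr
  have s₃ : ‖v₃ - v₁‖ ^ 2 ≤ r ^ 2 := by gcongr
  have hfin : (a₁ * l₁ + a₂ * l₂ + a₃ * l₃) ^ 2 ≤ (r * l / √3) ^ 2 := by
    rw [div_pow, Real.sq_sqrt (by norm_num)]
    have t₁ := mul_le_mul_of_nonneg_left s₁ (mul_nonneg n₁ n₂)
    have t₂ := mul_le_mul_of_nonneg_left s₂ (mul_nonneg n₂ n₃)
    have t₃ := mul_le_mul_of_nonneg_left s₃ (mul_nonneg n₃ n₁)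
    have : r ^ 2 * (l₁ * l₂ + l₂ * l₃ + l₃ * l₁) ≤ (r * l) ^ 2 / 3 := by
      have : l₁ * l₂ + l₂ * l₃ + l₃ * l₁ ≤ l ^ 2 / 3 := by
        rw [hl]
        nlinarith [sq_nonneg (l₁ - l₂), sq_nonneg (l₂ - l₃), sq_nonneg (l₃ - l₁)]
      calc _ ≤ r ^ 2 * (l ^ 2 / 3) := by gcongr
        _ = _ := by ring
    linarith
  exact hle.trans (abs_le_of_sq_le_sq' hfin (by positivity)).2

/-- If a triangle cannot be translated into the interior of `K`, then some width of `K` is at most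
the perimeter of the triangle divided by `√3`. -/
theorem exists_width_le_of_not_fits [CompleteSpace E] {K : Set E} (hK : Convex ℝ K)
    (hne : (interior K).Nonempty) {a b c : E}
    (h : ∀ t, ¬ (a - t ∈ interior K ∧ b - t ∈ interior K ∧ c - t ∈ interior K)) :
    ∃ n : E, ‖n‖ = 1 ∧ ∀ x ∈ K, ∀ y ∈ K,
      ⟪n, x - y⟫ ≤ (dist a b + dist b c + dist c a) / √3 := by
  obtain ⟨u, v, w, hsum, hlt⟩ := exists_normals_of_not_fits hK hne h
  have hw : w = -u - v := by rw [← sub_eq_zero, ← hsum]; abel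
  set P := dist a b + dist b c + dist c a with hP
  have key : ∀ r, ‖u‖ ≤ r → ‖v‖ ≤ r → ‖w‖ ≤ r →
      ⟪u, a⟫ + ⟪v, b⟫ + ⟪w, c⟫ ≤ r * P / √3 := by
    intro r hu hv hw'
    -- Summation by parts: the points -u, w, 0 have mutual distances ‖v‖, ‖w‖, ‖u‖.
    have := sum_inner_le_of_norm_sub_le (d₁ := b - a) (d₂ := c - b) (d₃ := a - c) (v₁ := -u)
      (v₂ := w) (v₃ := 0) (by abel) (r := r) (by rw [hw]; simpa using hv) (by simpa using hw')
      (by simpa using hu)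
    rw [← dist_eq_norm, ← dist_eq_norm, ← dist_eq_norm, dist_comm b a, dist_comm c b,
      dist_comm a c, ← hP] at this
    refine le_trans (le_of_eq ?_) this
    simp only [hw, inner_sub_left, inner_sub_right, inner_neg_left, inner_zero_left]
    ring
  have main : ∀ r, ‖u‖ ≤ r → ‖v‖ ≤ r → ‖w‖ ≤ r → ∀ z : E, ‖z‖ = r →
      (∀ x ∈ interior K, ∀ y ∈ interior K, ⟪z, x - y⟫ < ⟪u, a⟫ + ⟪v, b⟫ + ⟪w, c⟫) →
      ∃ n : E, ‖n‖ = 1 ∧ ∀ x ∈ K, ∀ y ∈ K, ⟪n, x - y⟫ ≤ P / √3 := by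
    intro r hu hv hw' z hz hxy
    have hz0 : z ≠ 0 := by
      rintro rfl
      obtain ⟨x, hx⟩ := hne
      have hr : r = 0 := by simpa using hz.symm
      have h1 := hxy x hx x hx
      have h2 := key r hu hv hw'
      simp [hr] at h1 h2
      linarith
    have hr : 0 < r := hz ▸ norm_pos_iff.2 hz0
    refine ⟨r⁻¹ • z, by rw [norm_smul, hz, norm_inv, Real.norm_of_nonneg hr.le,
      inv_mul_cancel₀ hr.ne'], fun x hx y hy => ?_⟩
    -- The bound extends from the interior to `K` because `K` lies in the closure of its interior.
    have hcl : K ×ˢ K ⊆ {p : E × E | ⟪r⁻¹ • z, p.1 - p.2⟫ ≤ P / √3} := by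
      have hsub : K ⊆ closure (interior K) := by
        rw [hK.closure_interior_eq_closure_of_nonempty_interior hne]
        exact subset_closure
      refine (Set.prod_mono hsub hsub).trans ?_
      rw [← closure_prod_eq]
      refine closure_minimal ?_ (isClosed_le (by fun_prop) continuous_const)
      rintro ⟨x, y⟩ ⟨hx, hy⟩
      have := (hxy x hx y hy).le.trans (key r hu hv hw')
      simp only [Set.mem_ofPred_eq, real_inner_smul_left]
      rw [inv_mul_le_iff₀ hr]
      rwa [mul_div_assoc] at this
    exact hcl (Set.mk_mem_prod hx hy)
  rcases le_total ‖u‖ ‖v‖ with h1 | h1 <;> rcases le_total ‖v‖ ‖w‖ with h2 | h2 <;>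
    rcases le_total ‖u‖ ‖w‖ with h3 | h3
  -- `z` is the longest normal; the other two, evaluated at the same `y`, add up to -⟪z, y⟫.
  all_goals first
    | refine main ‖u‖ (by linarith) (by linarith) (by linarith) u rfl fun x hx y hy =>
        lt_of_eq_of_lt ?_ (hlt x hx y hy y hy)
      simp only [hw, inner_sub_left, inner_sub_right, inner_neg_left]; ring
    | refine main ‖v‖ (by linarith) (by linarith) (by linarith) v rfl fun x hx y hy =>
        lt_of_eq_of_lt ?_ (hlt y hy x hx y hy)
      simp only [hw, inner_sub_left, inner_sub_right, inner_neg_left]; ring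
    | refine main ‖w‖ (by linarith) (by linarith) (by linarith) w rfl fun x hx y hy =>
        lt_of_eq_of_lt ?_ (hlt y hy y hy x hx)
      simp only [hw, inner_sub_left, inner_sub_right, inner_neg_left]; ring

/-- A linear functional is strictly below its upper bound on the interior of a set. -/
theorem inner_lt_of_mem_interior {S : Set E} {n : E} (hn : n ≠ 0) {M : ℝ}
    (hS : ∀ x ∈ S, ⟪n, x⟫ ≤ M) {y : E} (hy : y ∈ interior S) : ⟪n, y⟫ < M := by
  obtain ⟨ε, hε, hball⟩ := Metric.isOpen_iff.1 isOpen_interior y hy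
  have hn' := norm_pos_iff.2 hn
  have hmem : y + (ε / 2 / ‖n‖) • n ∈ S := by
    apply interior_subset (hball _)
    rw [Metric.mem_ball, dist_eq_norm, add_sub_cancel_left, norm_smul, Real.norm_of_nonneg
      (by positivity), div_mul_cancel₀ _ hn'.ne']
    linarith
  have := hS _ hmem
  rw [inner_add_right, real_inner_smul_right, real_inner_self_eq_norm_sq] at this
  have : 0 < ε / 2 / ‖n‖ * ‖n‖ ^ 2 := by positivity
  linarith

/-- A bouncing ball orbit across `K - K` in the direction `n`. -/
theorem xi_sub_self_le_of_width {K : Set E} {n : E} (hn : ‖n‖ = 1) {W : ℝ} (hW : 0 ≤ W)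
    (hK : ∀ x ∈ K, ∀ y ∈ K, ⟪n, x - y⟫ ≤ W) : xi (K - K) ≤ 4 * W := by
  refine csInf_le (nonFittingLengths_bddBelow _) ⟨2, ![-(W • n), W • n], le_rfl, ?_, ?_⟩
  · rintro ⟨t, ht⟩
    have h1 := ht ⟨0, rfl⟩
    have h2 := ht ⟨1, rfl⟩
    rw [Set.mem_vadd_set_iff_neg_vadd_mem, vadd_eq_add] at h1 h2
    simp only [Matrix.cons_val_zero, Matrix.cons_val_one] at h1 h2
    have hn0 : n ≠ 0 := norm_ne_zero_iff.1 (by rw [hn]; norm_num)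
    -- `K - K` lies in a slab of thickness 2W, whose interior cannot hold two points 2W apart along
    -- `n`.
    have b1 := inner_lt_of_mem_interior (neg_ne_zero.2 hn0) (M := W) (by
      rintro _ ⟨x, hx, y, hy, rfl⟩
      have := hK y hy x hx
      simp only [inner_neg_left, inner_sub_right] at this ⊢
      linarith) h1
    have b2 := inner_lt_of_mem_interior hn0 (M := W) (by
      rintro _ ⟨x, hx, y, hy, rfl⟩
      exact hK x hx y hy) h2
    simp only [inner_neg_left, inner_add_right, inner_neg_right, real_inner_smul_right,
      real_inner_self_eq_norm_sq, hn] at b1 b2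
    linarith
  · have e : W • n - -(W • n) = (2 * W) • n := by rw [two_mul, add_smul]; abel
    have e' : -(W • n) - W • n = -((2 * W) • n) := by rw [two_mul, add_smul]; abel
    simp only [closedLength, Fin.sum_univ_two, finRotate_apply]
    simp only [zero_add, Fin.isValue, Matrix.cons_val_one, Matrix.cons_val_zero, e,
      show (1 + 1 : Fin 2) = 0 from rfl, e', norm_neg, norm_smul, hn]
    rw [Real.norm_of_nonneg (by positivity)]
    ring

theorem xi_sub_self_le [FiniteDimensional ℝ E] (hE : Module.finrank ℝ E = 2) {K : Set E}
    (hK : Convex ℝ K) (hne : (interior K).Nonempty) (hb : Bornology.IsBounded K) :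
    xi (K - K) ≤ 4 / √3 * xi K := by
  have : Nontrivial E := Module.nontrivial_of_finrank_pos (R := ℝ) (by omega)
  have : CompleteSpace E := FiniteDimensional.complete ℝ E
  rw [← div_le_iff₀' (by positivity)]
  refine le_csInf (nonFittingLengths_nonempty hb) ?_
  rintro _ ⟨m, q, hm, hq, rfl⟩
  rw [div_le_iff₀' (by positivity)]
  obtain ⟨i, j, k, hijk⟩ := exists_triple_of_not_fitsInterior hE hK hm hq
  obtain ⟨n, hn, hw⟩ := exists_width_le_of_not_fits hK hne hijk
  have := xi_sub_self_le_of_width hn (by positivity) hw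
  refine this.trans ?_
  rw [div_mul_eq_mul_div, mul_div_assoc]
  gcongr
  exact triangle_le_closedLength q i j k

end Inner

/-! ### Enclosing a triangle in a ball -/

section Ball

variable {E : Type*} [NormedAddCommGroup E] [NormedSpace ℝ E]

/-- A triangle of perimeter `P` lies in a ball of radius `P / 4`: the center is the midpoint between
a vertex and the point of the boundary that bisects the perimeter. -/
theorem exists_dist_le_quarter_perimeter (a b c : E) :
    ∃ o, dist a o ≤ (dist a b + dist b c + dist c a) / 4 ∧
      dist b o ≤ (dist a b + dist b c + dist c a) / 4 ∧
      dist c o ≤ (dist a b + dist b c + dist c a) / 4 := by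
  set P := dist a b + dist b c + dist c a with hP
  have t1 := dist_triangle c b a
  have t2 := dist_triangle a c b
  rw [dist_comm c b, dist_comm b a] at t1
  rw [dist_comm a c, dist_comm c b] at t2
  -- `b'` on side bc halves the perimeter measured from `a`. If b = c, then P / 2 = dist a b, so the
  -- default s = 0 is right.
  let s := (P / 2 - dist a b) / dist b c
  have hs : s * dist b c = P / 2 - dist a b := by
    rcases eq_or_ne (dist b c) 0 with h | h
    · rw [h, mul_zero]
      linarith
    · exact div_mul_cancel₀ _ h
  have hs0 : 0 ≤ s := div_nonneg (by linarith) dist_nonneg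
  have hs1 : s ≤ 1 := div_le_one_of_le₀ (by linarith) dist_nonneg
  let b' := AffineMap.lineMap b c s
  have hb : dist b' b = P / 2 - dist a b := by
    rw [dist_lineMap_left, Real.norm_of_nonneg hs0, hs]
  have hc : dist b' c = dist b c - (P / 2 - dist a b) := by
    rw [dist_lineMap_right, Real.norm_of_nonneg (by linarith), sub_mul, hs, one_mul]
  have hmid : ∀ x, dist x (midpoint ℝ a b') ≤ (dist x a + dist x b') / 2 := by
    intro x
    have := dist_midpoint_midpoint_le x x a b'
    simpa using this
  refine ⟨midpoint ℝ a b', (hmid a).trans ?_, (hmid b).trans ?_, (hmid c).trans ?_⟩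
  · have := dist_triangle a b b'
    rw [dist_comm b b', hb] at this
    rw [dist_self]
    linarith
  · rw [dist_comm b b', hb, dist_comm b a]
    linarith
  · rw [dist_comm c b', hc]
    linarith

end Ball

/-! ### Equality for equilateral triangles -/

section Equilateral

local notation "⟪" x ", " y "⟫" => inner ℝ x y

/-- The shortest closed billiard trajectory in a planar convex set containing a ball of radius `r`
has length at least `4 * r`. -/
theorem four_mul_le_xi_of_ball_subset {C : Set Plane} (hC : Convex ℝ C)
    (hb : Bornology.IsBounded C) {r : ℝ} (h : Metric.ball 0 r ⊆ C) : 4 * r ≤ xi C := by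
  refine le_csInf (nonFittingLengths_nonempty hb) ?_
  rintro _ ⟨m, q, hm, hq, rfl⟩
  obtain ⟨i, j, k, hijk⟩ := exists_triple_of_not_fitsInterior (by simp) hC hm hq
  by_contra! hlt
  have hP := triangle_le_closedLength q i j k
  obtain ⟨o, hi, hj, hk⟩ := exists_dist_le_quarter_perimeter (q i) (q j) (q k)
  have hsub : ∀ x, dist x o < r → x - o ∈ interior C := fun x hx =>
    interior_maximal h Metric.isOpen_ball (by rwa [mem_ball_zero_iff, ← dist_eq_norm])
  exact hijk o ⟨hsub _ (by linarith), hsub _ (by linarith), hsub _ (by linarith)⟩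

/-- The Gram determinant of three vectors in the plane vanishes. -/
theorem Plane.gram_det_eq_zero (x y z : Plane) :
    ⟪x, x⟫ * (⟪y, y⟫ * ⟪z, z⟫ - ⟪y, z⟫ ^ 2) - ⟪x, y⟫ * (⟪x, y⟫ * ⟪z, z⟫ - ⟪y, z⟫ * ⟪x, z⟫)
      + ⟪x, z⟫ * (⟪x, y⟫ * ⟪y, z⟫ - ⟪y, y⟫ * ⟪x, z⟫) = 0 := by
  simp only [PiLp.inner_apply, Fin.sum_univ_two, RCLike.inner_apply, conj_trivial]
  ring

variable {p : Fin 3 → Plane} {a : ℝ}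

/-- The width of an equilateral triangle is at least its altitude in every direction. -/
theorem exists_altitude_le_inner_sub (ha : 0 < a) (hp : Pairwise fun i j => dist (p i) (p j) = a)
    (n : Plane) : ∃ i j, a * √3 / 2 * ‖n‖ ≤ ⟪n, p i - p j⟫ := by
  set x := p 1 - p 0
  set y := p 2 - p 1
  have hz : p 0 - p 2 = -(x + y) := by simp only [x, y]; abel
  have hx : ‖x‖ = a := by rw [← dist_eq_norm]; exact hp (by decide)
  have hy : ‖y‖ = a := by rw [← dist_eq_norm]; exact hp (by decide)
  have hxy : ‖x + y‖ = a := by rw [← norm_neg, ← hz, ← dist_eq_norm]; exact hp (by decide)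
  have hin : ⟪x, y⟫ = -(a ^ 2 / 2) := by
    have := norm_add_sq_real x y
    rw [hx, hy, hxy] at this
    linarith
  -- Linear dependence of n, x, y in the plane determines s² + st + t² from ‖n‖.
  have hg := Plane.gram_det_eq_zero n x y
  simp only [real_inner_self_eq_norm_sq, hx, hy, hin] at hg
  set s := ⟪n, x⟫ with hs
  set t := ⟪n, y⟫ with ht
  have hH : s ^ 2 + s * t + t ^ 2 = (a * √3 / 2 * ‖n‖) ^ 2 := by
    have : (a * √3 / 2 * ‖n‖) ^ 2 = 3 / 4 * a ^ 2 * ‖n‖ ^ 2 := by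
      rw [mul_pow, div_pow, mul_pow, Real.sq_sqrt (by norm_num)]
      ring
    rw [this]
    have ha2 : a ^ 2 ≠ 0 := by positivity
    apply mul_left_cancel₀ ha2
    linarith
  have hH0 : 0 ≤ a * √3 / 2 * ‖n‖ := by positivity
  set H := a * √3 / 2 * ‖n‖
  have conclude : ∀ (w : ℝ) (i j : Fin 3), w = ⟪n, p i - p j⟫ → H ^ 2 ≤ w ^ 2 →
      ∃ i j, H ≤ ⟪n, p i - p j⟫ := by
    intro w i j hw hle
    rw [sq_le_sq, abs_of_nonneg hH0] at hle
    rcases le_abs.1 hle with h | h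
    · exact ⟨i, j, hw ▸ h⟩
    · refine ⟨j, i, ?_⟩
      rw [← neg_sub, inner_neg_right, ← hw]
      exact h
  -- Up to sign, s, t and s + t pair `n` with the three sides. The largest in modulus is s + t if st
  -- ≥ 0, otherwise s or t.
  rcases le_total 0 (s * t) with h | h
  · refine conclude (s + t) 2 0 ?_ (by linarith)
    rw [hs, ht, ← inner_add_right]
    simp only [x, y]
    congr 1
    abel
  have hmul : ∀ x y : ℝ, x * y ≤ 0 → |y| ≤ |x| → x * y + y ^ 2 ≤ 0 := by
    intro x y hxy hle
    have := mul_le_mul_of_nonneg_right hle (abs_nonneg y)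
    rw [abs_mul_abs_self, ← abs_mul, abs_of_nonpos hxy] at this
    linarith
  rcases le_total |t| |s| with h' | h'
  · exact conclude s 1 0 rfl (by linarith [hmul s t h h'])
  · exact conclude t 2 1 rfl (by linarith [hmul t s (by linarith) h'])

/-- A point outside the compact convex difference body would be separated from it by some `n`, but
along `n` the body reaches at least the altitude times ‖n‖. -/
theorem ball_subset_convexHull_sub (ha : 0 < a) (hp : Pairwise fun i j => dist (p i) (p j) = a) :
    Metric.ball 0 (a * √3 / 2) ⊆
      convexHull ℝ (Set.range p) - convexHull ℝ (Set.range p) := by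
  intro y hy
  by_contra hmem
  have hcomp : IsCompact (convexHull ℝ (Set.range p)) :=
    (Set.finite_range p).isCompact_convexHull ℝ
  have hconv := convex_convexHull ℝ (Set.range p)
  obtain ⟨f, u, hf, hu⟩ := geometric_hahn_banach_closed_point (hconv.sub hconv)
    (sub_eq_add_neg (convexHull ℝ (Set.range p)) _ ▸ (hcomp.add hcomp.neg).isClosed) hmem
  let n := (InnerProductSpace.toDual ℝ Plane).symm f
  have hn : ∀ x, ⟪n, x⟫ = f x := fun x => InnerProductSpace.toDual_symm_apply
  obtain ⟨i, j, hij⟩ := exists_altitude_le_inner_sub ha hp n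
  have h1 := hf (p i - p j) (Set.sub_mem_sub (subset_convexHull _ _ ⟨i, rfl⟩)
    (subset_convexHull _ _ ⟨j, rfl⟩))
  have h2 := real_inner_le_norm n y
  rw [hn] at hij h2
  rw [mem_ball_zero_iff] at hy
  have h3 : ‖n‖ * ‖y‖ ≤ a * √3 / 2 * ‖n‖ := by
    rw [mul_comm]
    gcongr
  linarith

theorem le_xi_convexHull_sub (ha : 0 < a) (hp : Pairwise fun i j => dist (p i) (p j) = a) :
    2 * √3 * a ≤ xi (convexHull ℝ (Set.range p) - convexHull ℝ (Set.range p)) := by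
  have hconv := convex_convexHull ℝ (Set.range p)
  have hb : Bornology.IsBounded (convexHull ℝ (Set.range p)) :=
    ((Set.finite_range p).isCompact_convexHull ℝ).isBounded
  refine le_trans (le_of_eq ?_) (four_mul_le_xi_of_ball_subset (hconv.sub hconv)
    (hb.sub hb) (ball_subset_convexHull_sub ha hp))
  ring

/-- The side of an equilateral triangle opposite to `p i` supports the triangle. -/
theorem inner_lt_midpoint_of_mem_interior (ha : 0 < a)
    (hp : Pairwise fun i j => dist (p i) (p j) = a) {i j k : Fin 3} (hij : i ≠ j) (hik : i ≠ k)
    (hjk : j ≠ k) {x : Plane} (hx : x ∈ interior (convexHull ℝ (Set.range p))) :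
    ⟪(p j - p i) + (p k - p i), x⟫ <
      ⟪(p j - p i) + (p k - p i), midpoint ℝ (p j) (p k)⟫ := by
  set v := p j - p i
  set w := p k - p i
  have hv : ‖v‖ = a := by rw [← dist_eq_norm]; exact hp hij.symm
  have hw : ‖w‖ = a := by rw [← dist_eq_norm]; exact hp hik.symm
  have hvw : ‖v - w‖ = a := by
    rw [show v - w = p j - p k by simp only [v, w]; abel, ← dist_eq_norm]; exact hp hjk
  have hin : 2 * ⟪v, w⟫ = a ^ 2 := by
    have := norm_sub_sq_real v w
    rw [hv, hw, hvw] at this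
    linarith
  have hpj : p j = p i + v := by simp only [v]; abel
  have hpk : p k = p i + w := by simp only [w]; abel
  have hpos : 0 < ⟪v + w, v⟫ := by
    rw [inner_add_left, real_inner_self_eq_norm_sq, hv, real_inner_comm]
    have : 0 < a ^ 2 := by positivity
    linarith
  have hne : v + w ≠ 0 := by
    intro h0
    rw [h0, inner_zero_left] at hpos
    exact hpos.false
  have heq : ⟪v + w, w⟫ = ⟪v + w, v⟫ := by
    simp only [inner_add_left, real_inner_self_eq_norm_sq, hv, hw, real_inner_comm w v]
    ring
  have hmid : ⟪v + w, midpoint ℝ (p j) (p k)⟫ = ⟪v + w, p i⟫ + ⟪v + w, v⟫ := by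
    rw [midpoint_eq_smul_add, real_inner_smul_right, hpj, hpk, inner_add_right, inner_add_right,
      inner_add_right, heq]
    simp only [invOf_eq_inv]
    ring
  refine inner_lt_of_mem_interior hne (fun y hy => ?_) hx
  refine convexHull_min (t := {y | ⟪v + w, y⟫ ≤ ⟪v + w, midpoint ℝ (p j) (p k)⟫}) ?_
    (convex_halfSpace_le (innerₛₗ ℝ (v + w)).isLinear _) hy
  rintro _ ⟨l, rfl⟩
  show ⟪v + w, p l⟫ ≤ _
  rw [hmid]
  have hl : l = i ∨ l = j ∨ l = k := by
    clear * - hij hik hjk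
    decide +revert
  rcases hl with rfl | rfl | rfl
  · linarith
  · rw [hpj, inner_add_right]
  · rw [hpk, inner_add_right, heq]

/-- The medial triangle of an equilateral triangle does not fit into its interior. -/
theorem xi_convexHull_le (ha : 0 < a) (hp : Pairwise fun i j => dist (p i) (p j) = a) :
    xi (convexHull ℝ (Set.range p)) ≤ 3 / 2 * a := by
  refine csInf_le (nonFittingLengths_bddBelow _) ⟨3, ![midpoint ℝ (p 1) (p 2),
    midpoint ℝ (p 2) (p 0), midpoint ℝ (p 0) (p 1)], by norm_num, ?_, ?_⟩
  · rintro ⟨t, ht⟩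
    have h0 := ht ⟨0, rfl⟩
    have h1 := ht ⟨1, rfl⟩
    have h2 := ht ⟨2, rfl⟩
    rw [Set.mem_vadd_set_iff_neg_vadd_mem, vadd_eq_add] at h0 h1 h2
    -- Each inequality says that `t` has positive product with one side normal; the three normals
    -- sum to zero.
    have b0 := inner_lt_midpoint_of_mem_interior ha hp (i := 0) (j := 1) (k := 2) (by decide)
      (by decide) (by decide) h0
    have b1 := inner_lt_midpoint_of_mem_interior ha hp (i := 1) (j := 2) (k := 0) (by decide)
      (by decide) (by decide) h1
    have b2 := inner_lt_midpoint_of_mem_interior ha hp (i := 2) (j := 0) (k := 1) (by decide)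
      (by decide) (by decide) h2
    simp only [Matrix.cons_val, inner_add_right _ (-t), inner_neg_right] at b0 b1 b2
    simp only [inner_add_left, inner_sub_left] at b0 b1 b2
    linarith
  · have hm : ∀ x y z : Plane, ‖midpoint ℝ y z - midpoint ℝ x y‖ = dist x z / 2 := by
      intro x y z
      rw [midpoint_eq_smul_add, midpoint_eq_smul_add, ← smul_sub, norm_smul, dist_comm,
        dist_eq_norm]
      simp only [invOf_eq_inv, norm_inv, Real.norm_ofNat]
      rw [show y + z - (x + y) = z - x by abel]
      ring
    simp only [closedLength, Fin.sum_univ_three, finRotate_apply]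
    simp only [Fin.isValue, zero_add, show (1 + 1 : Fin 3) = 2 from rfl,
      show (2 + 1 : Fin 3) = 0 from rfl, Matrix.cons_val, hm]
    rw [hp (show (1 : Fin 3) ≠ 0 by decide), hp (show (2 : Fin 3) ≠ 1 by decide),
      hp (show (0 : Fin 3) ≠ 2 by decide)]
    ring

theorem four_div_sqrt_three_mul (a : ℝ) : 4 / √3 * (3 / 2 * a) = 2 * √3 * a := by
  have h : √3 * √3 = 3 := Real.mul_self_sqrt (by norm_num)
  have h0 : √3 ≠ 0 := by positivity
  field_simp
  rw [Real.sq_sqrt (by norm_num)]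
  ring

theorem interior_convexHull_simplex_nonempty (s : Affine.Simplex ℝ Plane 2) :
    (interior (convexHull ℝ (Set.range s.points))).Nonempty := by
  rw [interior_convexHull_nonempty_iff_affineSpan_eq_top]
  exact s.independent.affineSpan_eq_top_iff_card_eq_finrank_add_one.2 (by simp)

theorem Affine.Simplex.Equilateral.exists_dist_eq_pos {s : Affine.Simplex ℝ Plane 2}
    (hs : s.Equilateral) : ∃ a, 0 < a ∧ Pairwise fun i j => dist (s.points i) (s.points j) = a := by
  obtain ⟨a, h⟩ := hs
  refine ⟨a, ?_, fun i j hij => h i j hij⟩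
  rw [← h 0 1 (by decide), dist_pos]
  exact s.independent.injective.ne (by decide)

/-- The general inequality gives ≤; the disc bound for `K - K` against the medial triangle in `K`
gives ≥. -/
theorem Affine.Simplex.Equilateral.xi_sub_self_eq {s : Affine.Simplex ℝ Plane 2}
    (hs : s.Equilateral) :
    xi (convexHull ℝ (Set.range s.points) - convexHull ℝ (Set.range s.points)) =
        4 / √3 * xi (convexHull ℝ (Set.range s.points)) := by
  obtain ⟨a, ha, hp⟩ := hs.exists_dist_eq_pos
  refine le_antisymm (xi_sub_self_le (by simp) (convex_convexHull _ _)
    (interior_convexHull_simplex_nonempty s)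
    ((Set.finite_range _).isCompact_convexHull ℝ).isBounded) ?_
  refine le_trans ?_ (le_xi_convexHull_sub ha hp)
  rw [← four_div_sqrt_three_mul]
  gcongr
  exact xi_convexHull_le ha hp

theorem Affine.Simplex.Equilateral.xi_convexHull_pos {s : Affine.Simplex ℝ Plane 2}
    (hs : s.Equilateral) : 0 < xi (convexHull ℝ (Set.range s.points)) := by
  obtain ⟨a, ha, hp⟩ := hs.exists_dist_eq_pos
  have h := le_xi_convexHull_sub ha hp
  rw [hs.xi_sub_self_eq] at h
  exact pos_of_mul_pos_right (lt_of_lt_of_le (by positivity) h) (by positivity)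

theorem exists_equilateral_simplex : ∃ s : Affine.Simplex ℝ Plane 2, s.Equilateral := by
  have h3 : √3 ^ 2 = 3 := Real.sq_sqrt (by norm_num)
  have hind : AffineIndependent ℝ (![!₂[0, 0], !₂[1, 0], !₂[1 / 2, √3 / 2]] : Fin 3 → Plane) := by
    rw [affineIndependent_iff_not_collinear_set,
      collinear_iff_of_mem (p₀ := (!₂[0, 0] : Plane)) (by simp)]
    rintro ⟨v, hv⟩
    obtain ⟨r, hr⟩ := hv !₂[1, 0] (by simp)
    obtain ⟨t, ht⟩ := hv !₂[1 / 2, √3 / 2] (by simp)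
    have r0 := congrArg (fun z : Plane => z 0) hr
    have r1 := congrArg (fun z : Plane => z 1) hr
    have t1 := congrArg (fun z : Plane => z 1) ht
    simp at r0 r1 t1
    rcases r1 with h | h
    · simp [h] at r0
    · simp [h] at t1
  refine ⟨⟨_, hind⟩, 1, fun i j hij => ?_⟩
  fin_cases i <;> fin_cases j <;> first | exact absurd rfl hij | skip
  all_goals
    simp [EuclideanSpace.dist_eq, Fin.sum_univ_two, Real.dist_eq, sq_abs, div_pow, h3]
    try norm_num

end Equilateral

theorem mainTheorem3 :
    (∀ K : ConvexBody Plane, (interior (K : Set Plane)).Nonempty →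
      xi ((K : Set Plane) - (K : Set Plane)) ≤ 4 / Real.sqrt 3 * xi (K : Set Plane)) ∧
    (∀ c : ℝ,
      (∀ K : ConvexBody Plane, (interior (K : Set Plane)).Nonempty →
        xi ((K : Set Plane) - (K : Set Plane)) ≤ c * xi (K : Set Plane)) →
      4 / Real.sqrt 3 ≤ c) ∧
    (∀ s : Affine.Simplex ℝ Plane 2, s.Equilateral →
      xi (convexHull ℝ (Set.range s.points) - convexHull ℝ (Set.range s.points)) =
        4 / Real.sqrt 3 * xi (convexHull ℝ (Set.range s.points))) := by
  refine ⟨fun K hK => xi_sub_self_le (by simp) K.convex hK K.isBounded, fun c hc => ?_,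
    fun s hs => hs.xi_sub_self_eq⟩
  obtain ⟨s, hs⟩ := exists_equilateral_simplex
  have h := hc ⟨convexHull ℝ (Set.range s.points), convex_convexHull _ _,
    (Set.finite_range _).isCompact_convexHull ℝ, (Set.range_nonempty _).convexHull⟩
    (interior_convexHull_simplex_nonempty s)
  -- A single equilateral triangle suffices, as its `xi` is positive and cancels.
  exact le_of_mul_le_mul_right (hs.xi_sub_self_eq.symm.le.trans h) hs.xi_convexHull_pos
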